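/- Let $d\ge 1$, let $A,B\in\mathbb{R}^{d\times d}$ be symmetric positive definite, and let $\Sigma\in\mathbb{R}^{2d\times 2d}$ be symmetric positive definite, with inverse written in $d\times d$ blocks as $$\Gamma:=\Sigma^{-1}=\begin{pmatrix}\Gamma_{11}&\Gamma_{12}\\ \Gamma_{12}^T&\Gamma_{22}\end{pmatrix}.$$ Let $\mu=N_d(A)$, $\nu=N_d(B)$ and $N_{2d}(\Sigma)$ be the centered Gaussian measures on $\mathbb{R}^d$, $\mathbb{R}^d$ and $\mathbb{R}^d\times\mathbb{R}^d$ with covariance matrices $A$, $B$ and $\Sigma$. Let $\Pi(\mu,\nu)$ be the set of all probability measures on $\mathbb{R}^d\times\mathbb{R}^d$ with first marginal $\mu$ and second marginal $\nu$. Let $\mathrm{KL}(\pi|\rho)=\int\log\frac{d\pi}{d\rho}\,d\pi$ if $\pi\ll\rho$, and $\mathrm{KL}(\pi|\rho)=+\infty$ otherwise. For $\varepsilon>0$ put $M_\varepsilon:=I_d-\varepsilon\,\Gamma_{12}$. Then $M_\varepsilon$ is invertible for all sufficiently small $\varepsilon>0$. Moreover, for every $\varepsilon>0$ such that $M_\varepsilon$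 is invertible, the problem $$\inf_{\pi\in\Pi(\mu,\nu)}\int_{\mathbb{R}^d\times\mathbb{R}^d}\|x-y\|^2\,d\pi(x,y)+2\varepsilon\,\mathrm{KL}\big(\pi\,|\,N_{2d}(\Sigma)\big)$$ has a unique solution (minimizer in $\Pi(\mu,\nu)$). It is the centered Gaussian measure $$\pi_\varepsilon^\star=N_{2d}\begin{pmatrix}A&C_\varepsilon\\ C_\varepsilon^T&B\end{pmatrix},\qquad C_\varepsilon=\Big[\big(AM_\varepsilon BM_\varepsilon^T+\tfrac{\varepsilon^2}{4}I_d\big)^{1/2}-\tfrac{\varepsilon}{2}I_d\Big](M_\varepsilon^T)^{-1},$$ the displayed block matrix being positive semidefinite. Here the square root of the not necessarily symmetric matrix is defined by $$\big(AM_\varepsilon BM_\varepsilon^T+\tfrac{\varepsilon^2}{4}I_d\big)^{1/2}:=A^{1/2}\big(A^{1/2}M_\varepsilon BM_\varepsilon^TA^{1/2}+\tfrac{\varepsilon^2}{4}I_d\big)^{1/2}A^{-1/2},$$ where the square roots on the right are the positive semidefinite ones. -/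

import Mathlib

open MeasureTheory Filter Topology
open scoped ENNReal

namespace EntropicOT

/-- The Euclidean space `ℝ^d`. -/
abbrev Space (d : ℕ) : Type := EuclideanSpace ℝ (Fin d)

/-- `N_d(A)`: the centered Gaussian measure on `ℝ^d` with covariance matrix `A`. -/
noncomputable def gaussian {d : ℕ} (A : Matrix (Fin d) (Fin d) ℝ) : Measure (Space d) :=
  ProbabilityTheory.multivariateGaussian 0 A

/-- `N_{2d}(X)`: the centered Gaussian measure on `ℝ^d × ℝ^d` with covariance matrix `X`, where
the two copies of `Fin d` in `Fin d ⊕ Fin d` index the coordinates of the two factors. -/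
noncomputable def gaussianProd {d : ℕ} (X : Matrix (Fin d ⊕ Fin d) (Fin d ⊕ Fin d) ℝ) :
    Measure (Space d × Space d) :=
  (ProbabilityTheory.multivariateGaussian 0 X).map EuclideanSpace.sumEquivProd

/-- `Π(μ, ν)`: the probability measures on `ℝ^d × ℝ^d` with marginals `μ` and `ν`. -/
def couplings {d : ℕ} (μ ν : Measure (Space d)) : Set (Measure (Space d × Space d)) :=
  {π | IsProbabilityMeasure π ∧ π.map Prod.fst = μ ∧ π.map Prod.snd = ν}

/-- The objective `∫ ‖x - y‖² dπ(x, y) + 2 ε KL(π | πref)`, with values in `[0, ∞]`. -/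
noncomputable def objective {d : ℕ} (ε : ℝ) (πref π : Measure (Space d × Space d)) : ℝ≥0∞ :=
  ∫⁻ p, ENNReal.ofReal (‖p.1 - p.2‖ ^ 2) ∂π
    + ENNReal.ofReal (2 * ε) * InformationTheory.klDiv π πref

/-- `π` solves the entropic optimal transport problem between `μ` and `ν` with reference `πref`:
it is a coupling which minimizes the objective among all couplings. -/
def IsSolution {d : ℕ} (ε : ℝ) (πref : Measure (Space d × Space d)) (μ ν : Measure (Space d))
    (π : Measure (Space d × Space d)) : Prop :=
  π ∈ couplings μ ν ∧ IsMinOn (objective ε πref) (couplings μ ν) π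

/-- `M_ε = I - ε Γ₁₂`, where `Γ₁₂` is the upper right block of `Γ = S⁻¹`. -/
noncomputable def Meps {d : ℕ} (S : Matrix (Fin d ⊕ Fin d) (Fin d ⊕ Fin d) ℝ) (ε : ℝ) :
    Matrix (Fin d) (Fin d) ℝ :=
  1 - ε • (S⁻¹).toBlocks₁₂

section
open scoped MatrixOrder

/-- The square root `A^{1/2} (A^{1/2} N A^{1/2} + (ε²/4) I)^{1/2} A^{-1/2}` of the (not necessarily
symmetric) matrix `A N + (ε²/4) I`, for `A` positive definite and `N` positive semidefinite;
`CFC.sqrt` is the square root of positive semidefinite matrices. -/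
noncomputable def sqrtShift {d : ℕ} (A N : Matrix (Fin d) (Fin d) ℝ) (ε : ℝ) :
    Matrix (Fin d) (Fin d) ℝ :=
  CFC.sqrt A * CFC.sqrt (CFC.sqrt A * N * CFC.sqrt A + (ε ^ 2 / 4) • 1) * (CFC.sqrt A)⁻¹

end

/-- `C_ε = [(A M_ε B M_εᵀ + (ε²/4) I)^{1/2} - (ε/2) I] (M_εᵀ)⁻¹`. -/
noncomputable def Ceps {d : ℕ} (A B : Matrix (Fin d) (Fin d) ℝ)
    (S : Matrix (Fin d ⊕ Fin d) (Fin d ⊕ Fin d) ℝ) (ε : ℝ) : Matrix (Fin d) (Fin d) ℝ :=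
  (sqrtShift A (Meps S ε * B * (Meps S ε).transpose) ε - (ε / 2) • 1) * ((Meps S ε).transpose)⁻¹

/-- The block matrix with rows `(A, C)` and `(Cᵀ, B)`. -/
def covOf {d : ℕ} (A B C : Matrix (Fin d) (Fin d) ℝ) :
    Matrix (Fin d ⊕ Fin d) (Fin d ⊕ Fin d) ℝ :=
  Matrix.fromBlocks A C C.transpose B

end EntropicOT

/-!
On couplings of `μ` and `ν`, adding a function of the form `a x + b y` to the integrand changes the
objective by a constant. Tilting the reference measure by `exp (a x + b y - ‖x - y‖² / (2 ε))`
therefore turns the objective into `2 ε KL(π | τ)` plus a constant, where `τ` is the normalised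
tilt. If `τ` is itself a coupling, it is the unique minimizer.

For nondegenerate Gaussian measures with covariance matrices `S` and `T`, the second is the tilt of
the first by the quadratic form of `(S⁻¹ - T⁻¹) / 2`, which has the required shape exactly when the
off-diagonal block of `S⁻¹ - T⁻¹` is `ε⁻¹ I`, that is, when `T⁻¹` has off-diagonal block
`-ε⁻¹ M_ε`. For `T = (A, C; Cᵀ, B)` and `C = G M_ε B` with `G` symmetric, this holds as soon as the
Schur complement `A - G M_ε B M_εᵀ G` of `B` in `T` equals `ε G`, which is a Riccati equation for
`G`. Substituting `G = A^{1/2} U⁻¹ A^{1/2}` turns it into `U² = K + ε U` with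
`K = A^{1/2} M_ε B M_εᵀ A^{1/2}`, whose positive definite root is found by completing the square.
-/

namespace EntropicOT

open Matrix ProbabilityTheory InformationTheory
open scoped MatrixOrder

section BlockMatrices

variable {m n : Type*} [Fintype n] [DecidableEq n]

lemma isUnit_fromBlocks_of_isUnit_schur {R : Type*} [CommRing R] [Fintype m] [DecidableEq m]
    {A : Matrix m m R} {B : Matrix m n R} {C : Matrix n m R} {D : Matrix n n R} (hD : IsUnit D)
    (hS : IsUnit (A - B * D⁻¹ * C)) : IsUnit (fromBlocks A B C D) := by
  let := hD.invertible
  rw [← invOf_eq_nonsing_inv] at hS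
  let := hS.invertible
  let := fromBlocks₂₂Invertible A B C D
  exact isUnit_of_invertible _

lemma toBlocks₁₂_inv_fromBlocks {R : Type*} [CommRing R] [Fintype m] [DecidableEq m]
    {A : Matrix m m R} {B : Matrix m n R} {C : Matrix n m R} {D : Matrix n n R} (hD : IsUnit D)
    (hS : IsUnit (A - B * D⁻¹ * C)) :
    (fromBlocks A B C D)⁻¹.toBlocks₁₂ = -((A - B * D⁻¹ * C)⁻¹ * B * D⁻¹) := by
  let := hD.invertible
  rw [← invOf_eq_nonsing_inv D] at hS ⊢
  let := hS.invertible
  let := fromBlocks₂₂Invertible A B C D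
  rw [← invOf_eq_nonsing_inv, invOf_fromBlocks₂₂_eq, toBlocks_fromBlocks₁₂, invOf_eq_nonsing_inv]

open scoped ComplexOrder in
lemma posDef_fromBlocks_of_posDef_schur {𝕜 : Type*} [RCLike 𝕜] [Finite m] {A : Matrix m m 𝕜}
    {B : Matrix m n 𝕜} {D : Matrix n n 𝕜} (hD : D.PosDef) (hS : (A - B * D⁻¹ * Bᴴ).PosDef) :
    (fromBlocks A B Bᴴ D).PosDef := by
  classical
  have := Fintype.ofFinite m
  let := hD.isUnit.invertible
  have hpsd : (fromBlocks A B Bᴴ D).PosSemidef := (PosDef.fromBlocks₂₂ A B hD).2 hS.posSemidef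
  exact hpsd.posDef_iff_isUnit.2 (isUnit_fromBlocks_of_isUnit_schur hD.isUnit hS.isUnit)

end BlockMatrices

section Riccati

variable {n : Type*} [Fintype n]

open scoped Classical in
lemma conjTranspose_sqrt (A : Matrix n n ℝ) : (CFC.sqrt A)ᴴ = CFC.sqrt A := 
  (CFC.sqrt_nonneg A).posSemidef.isHermitian

open scoped Classical in
lemma posSemidef_sqrt_mul_mul_sqrt (A : Matrix n n ℝ) {N : Matrix n n ℝ} (hN : N.PosSemidef) :
    (CFC.sqrt A * N * CFC.sqrt A).PosSemidef := by
  simpa only [conjTranspose_sqrt] using hN.mul_mul_conjTranspose_same (CFC.sqrt A)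

variable [DecidableEq n]

/-- The positive definite root `U = (K + (ε² / 4) I)^{1/2} + (ε / 2) I` of the quadratic matrix
equation `U² = K + ε U`, for `K` positive semidefinite. -/
noncomputable def quadraticRoot (K : Matrix n n ℝ) (ε : ℝ) : Matrix n n ℝ :=
  CFC.sqrt (K + (ε ^ 2 / 4) • 1) + (ε / 2) • 1

lemma posDef_quadraticRoot {K : Matrix n n ℝ} (hK : K.PosSemidef) {ε : ℝ} (hε : 0 < ε) :
    (quadraticRoot K ε).PosDef :=
  have hshift : (K + (ε ^ 2 / 4) • 1).PosDef := .posSemidef_add hK (.smul .one (by positivity))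
  hshift.isStrictlyPositive.sqrt.posDef.add (.smul .one (by positivity))

lemma quadraticRoot_mul_self {K : Matrix n n ℝ} (hK : K.PosSemidef) (ε : ℝ) :
    quadraticRoot K ε * quadraticRoot K ε = K + ε • quadraticRoot K ε := by
  have hshift : 0 ≤ K + (ε ^ 2 / 4) • 1 := (hK.add (.smul .one (by positivity))).nonneg
  have hsq := CFC.sqrt_mul_sqrt_self _ hshift
  simp only [quadraticRoot, add_mul, mul_add, smul_mul_assoc, mul_smul_comm, one_mul, mul_one, hsq]
  module

lemma inv_quadraticRoot_mul {K : Matrix n n ℝ} (hK : K.PosSemidef) {ε : ℝ} (hε : 0 < ε) :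
    (quadraticRoot K ε)⁻¹ * K = quadraticRoot K ε - ε • 1 := by
  have hdet := (isUnit_iff_isUnit_det _).1 (posDef_quadraticRoot hK hε).isUnit
  have hU := eq_sub_of_add_eq (quadraticRoot_mul_self hK ε).symm
  set U := quadraticRoot K ε
  rw [hU, mul_sub, nonsing_inv_mul_cancel_left _ _ hdet, mul_smul_comm, nonsing_inv_mul _ hdet]

/-- The positive definite solution `G` of the Riccati equation `G N G + ε G = A`, for `A` positive
definite and `N` positive semidefinite. Conjugating by `A^{1/2}` reduces the equation to the case
`A = I`, whose solution is the inverse of `quadraticRoot`. -/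
noncomputable def riccatiSol (A N : Matrix n n ℝ) (ε : ℝ) : Matrix n n ℝ :=
  CFC.sqrt A * (quadraticRoot (CFC.sqrt A * N * CFC.sqrt A) ε)⁻¹ * CFC.sqrt A

variable {A N : Matrix n n ℝ} {ε : ℝ}

lemma posDef_riccatiSol (hA : A.PosDef) (hN : N.PosSemidef) (hε : 0 < ε) :
    (riccatiSol A N ε).PosDef := by
  have hinv := (posDef_quadraticRoot (posSemidef_sqrt_mul_mul_sqrt A hN) hε).inv
  have hinj := mulVec_injective_iff_isUnit.2 hA.isStrictlyPositive.isUnit_cfcSqrt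
  simpa only [riccatiSol, conjTranspose_sqrt] using hinv.conjTranspose_mul_mul_same hinj

lemma riccatiSol_mul_mul_add_smul (hA : A.PosSemidef) (hN : N.PosSemidef) (hε : 0 < ε) :
    riccatiSol A N ε * N * riccatiSol A N ε + ε • riccatiSol A N ε = A := by
  have hK := posSemidef_sqrt_mul_mul_sqrt A hN
  have hdet := (isUnit_iff_isUnit_det _).1 (posDef_quadraticRoot hK hε).isUnit
  rw [riccatiSol]
  set R := CFC.sqrt A
  set U := quadraticRoot (R * N * R) ε
  have hU : U⁻¹ * (R * N * R) * U⁻¹ + ε • U⁻¹ = 1 := by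
    rw [inv_quadraticRoot_mul hK hε, sub_mul, mul_nonsing_inv _ hdet, smul_mul_assoc, one_mul,
      sub_add_cancel]
  calc R * U⁻¹ * R * N * (R * U⁻¹ * R) + ε • (R * U⁻¹ * R)
      = R * (U⁻¹ * (R * N * R) * U⁻¹ + ε • U⁻¹) * R := by
        simp only [mul_add, add_mul, mul_assoc, smul_mul_assoc, mul_smul_comm]
    _ = A := by rw [hU, mul_one, CFC.sqrt_mul_sqrt_self A hA.nonneg]

end Riccati

section OptimalCovariance

variable {d : ℕ} {A B G M N : Matrix (Fin d) (Fin d) ℝ}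
  {S : Matrix (Fin d ⊕ Fin d) (Fin d ⊕ Fin d) ℝ} {ε : ℝ}

lemma sqrtShift_sub_smul_one (hA : A.PosDef) (hN : N.PosSemidef) (hε : 0 < ε) :
    sqrtShift A N ε - (ε / 2) • 1 = riccatiSol A N ε * N := by
  have hdet := (isUnit_iff_isUnit_det _).1 hA.isStrictlyPositive.isUnit_cfcSqrt
  have hK := posSemidef_sqrt_mul_mul_sqrt A hN
  rw [sqrtShift, riccatiSol]
  set R := CFC.sqrt A
  set U := quadraticRoot (R * N * R) ε
  have hsqrt : CFC.sqrt (R * N * R + (ε ^ 2 / 4) • 1) = U⁻¹ * (R * N * R) + (ε / 2) • 1 := by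
    rw [inv_quadraticRoot_mul hK hε, ← sub_eq_iff_eq_add.2 (rfl : U = _)]
    module
  calc R * CFC.sqrt (R * N * R + (ε ^ 2 / 4) • 1) * R⁻¹ - (ε / 2) • 1
      = R * U⁻¹ * R * N * (R * R⁻¹) + (ε / 2) • (R * R⁻¹) - (ε / 2) • 1 := by
        rw [hsqrt]
        simp only [mul_add, add_mul, mul_assoc, mul_smul_comm, smul_mul_assoc, mul_one]
    _ = R * U⁻¹ * R * N := by rw [mul_nonsing_inv _ hdet, mul_one, add_sub_cancel_right]

lemma Ceps_eq_riccatiSol_mul (hA : A.PosDef) (hB : B.PosSemidef) (hε : 0 < ε)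
    (hM : IsUnit (Meps S ε)) :
    Ceps A B S ε =
      riccatiSol A (Meps S ε * B * (Meps S ε)ᵀ) ε * Meps S ε * B := by
  have hN : (Meps S ε * B * (Meps S ε)ᵀ).PosSemidef := hB.mul_mul_conjTranspose_same (Meps S ε)
  have hdet : IsUnit (Meps S ε)ᵀ.det := by
    rwa [det_transpose, ← isUnit_iff_isUnit_det]
  rw [Ceps, sqrtShift_sub_smul_one hA hN hε, ← mul_assoc, mul_nonsing_inv_cancel_right _ _ hdet,
    ← mul_assoc]

lemma schur_riccati (hB : B.PosDef) (hG : G.IsHermitian)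
    (hric : G * (M * B * Mᵀ) * G + ε • G = A) :
    A - G * M * B * B⁻¹ * (G * M * B)ᵀ = ε • G := by
  have hBdet := (isUnit_iff_isUnit_det _).1 hB.isUnit
  have hGt : Gᵀ = G := hG
  have hBt : Bᵀ = B := hB.isHermitian
  rw [mul_nonsing_inv_cancel_right _ _ hBdet, ← hric]
  simp only [transpose_mul, hGt, hBt, mul_assoc, add_sub_cancel_left]

lemma posDef_covOf_riccati (hB : B.PosDef) (hG : G.PosDef) (hε : 0 < ε)
    (hric : G * (M * B * Mᵀ) * G + ε • G = A) : (covOf A B (G * M * B)).PosDef := by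
  refine posDef_fromBlocks_of_posDef_schur hB ?_
  rw [conjTranspose_eq_transpose_of_trivial, schur_riccati hB hG.isHermitian hric]
  exact hG.smul hε

lemma toBlocks₁₂_inv_covOf_riccati (hB : B.PosDef) (hG : G.PosDef) (hε : 0 < ε)
    (hric : G * (M * B * Mᵀ) * G + ε • G = A) :
    (covOf A B (G * M * B))⁻¹.toBlocks₁₂ = -(ε⁻¹ • M) := by
  have hBdet := (isUnit_iff_isUnit_det _).1 hB.isUnit
  have hGdet := (isUnit_iff_isUnit_det _).1 hG.isUnit
  have hschur := schur_riccati hB hG.isHermitian hric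
  have hinv : (ε • G)⁻¹ = ε⁻¹ • G⁻¹ := inv_smul' _ (Units.mk0 ε hε.ne') hGdet
  rw [covOf, toBlocks₁₂_inv_fromBlocks hB.isUnit (hschur ▸ (hG.smul hε).isUnit), hschur, hinv,
    mul_assoc, mul_nonsing_inv_cancel_right _ _ hBdet, smul_mul_assoc,
    nonsing_inv_mul_cancel_left _ _ hGdet]

lemma posDef_covOf_Ceps (hA : A.PosDef) (hB : B.PosDef) (hε : 0 < ε) (hM : IsUnit (Meps S ε)) :
    (covOf A B (Ceps A B S ε)).PosDef := by
  have hN := hB.posSemidef.mul_mul_conjTranspose_same (Meps S ε)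
  rw [Ceps_eq_riccatiSol_mul hA hB.posSemidef hε hM]
  exact posDef_covOf_riccati hB (posDef_riccatiSol hA hN hε) hε
    (riccatiSol_mul_mul_add_smul hA.posSemidef hN hε)

lemma toBlocks₁₂_inv_sub_inv_covOf_Ceps (hA : A.PosDef) (hB : B.PosDef) (hε : 0 < ε)
    (hM : IsUnit (Meps S ε)) :
    (S⁻¹ - (covOf A B (Ceps A B S ε))⁻¹).toBlocks₁₂ = ε⁻¹ • 1 := by
  have hN := hB.posSemidef.mul_mul_conjTranspose_same (Meps S ε)
  have hblock := toBlocks₁₂_inv_covOf_riccati hB (posDef_riccatiSol hA hN hε) hε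
    (riccatiSol_mul_mul_add_smul hA.posSemidef hN hε)
  have hMeps : ε⁻¹ • Meps S ε = ε⁻¹ • 1 - (S⁻¹).toBlocks₁₂ := by
    rw [Meps, smul_sub, inv_smul_smul₀ hε.ne']
  rw [conjTranspose_eq_transpose_of_trivial, ← Ceps_eq_riccatiSol_mul hA hB.posSemidef hε hM]
    at hblock
  calc (S⁻¹ - (covOf A B (Ceps A B S ε))⁻¹).toBlocks₁₂
      = (S⁻¹).toBlocks₁₂ - -(ε⁻¹ • Meps S ε) := by rw [← hblock]; rfl
    _ = ε⁻¹ • 1 := by rw [hMeps, sub_neg_eq_add, add_sub_cancel]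

lemma eventually_isUnit_Meps (S : Matrix (Fin d ⊕ Fin d) (Fin d ⊕ Fin d) ℝ) :
    ∀ᶠ ε in 𝓝[>] (0 : ℝ), IsUnit (Meps S ε) := by
  have hcont : Continuous fun ε : ℝ => (Meps S ε).det := by unfold Meps; fun_prop
  have h0 : (Meps S 0).det ≠ 0 := by simp [Meps]
  filter_upwards [nhdsWithin_le_nhds (hcont.continuousAt.eventually_ne h0)] with ε h
  exact (isUnit_iff_isUnit_det _).2 (isUnit_iff_ne_zero.2 h)

end OptimalCovariance

section Tilting

variable {α β : Type*} {mα : MeasurableSpace α} {mβ : MeasurableSpace β} {μ : Measure α}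

lemma map_tilted_comp {g : α → β} (hg : Measurable g) {f : β → ℝ} (hf : Measurable f) :
    (μ.tilted (f ∘ g)).map g = (μ.map g).tilted f := by
  ext s hs
  rw [Measure.map_apply hg hs, tilted_apply' _ _ (hg hs), tilted_apply' _ _ hs,
    setLIntegral_map hs (by fun_prop) hg, integral_map hg.aemeasurable (by fun_prop)]
  rfl

lemma smul_tilted {c : ℝ≥0∞} (h0 : c ≠ 0) (htop : c ≠ ∞) (f : α → ℝ) :
    (c • μ).tilted f = μ.tilted f := by
  ext s hs
  have hc : 0 < c.toReal := ENNReal.toReal_pos h0 htop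
  rw [tilted_apply' _ _ hs, tilted_apply' _ _ hs, Measure.restrict_smul, lintegral_smul_measure,
    integral_smul_measure, smul_eq_mul, smul_eq_mul, ← lintegral_const_mul' _ _ htop]
  refine lintegral_congr fun x => ?_
  nth_rewrite 1 [← ENNReal.ofReal_toReal htop]
  rw [← ENNReal.ofReal_mul hc.le, mul_div_assoc', mul_div_mul_left _ _ hc.ne']

lemma integrable_exp_of_tilted_ne_zero {f : α → ℝ} (h : μ.tilted f ≠ 0) :
    Integrable (fun x => Real.exp (f x)) μ :=
  of_not_not fun hf => h (tilted_of_not_integrable hf)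

variable {ρ : Measure α} {f : α → ℝ}

lemma integrable_llr_tilted_right_iff [IsFiniteMeasure μ] [SigmaFinite ρ] (hμρ : μ ≪ ρ)
    (hfμ : Integrable f μ) (hfρ : Integrable (fun x => Real.exp (f x)) ρ) :
    Integrable (llr μ (ρ.tilted f)) μ ↔ Integrable (llr μ ρ) μ := by
  rw [integrable_congr (llr_tilted_right hμρ hfρ)]
  exact integrable_add_iff_integrable_right' (hfμ.neg.add (integrable_const _))

lemma klDiv_tilted_right_ne_top_iff [IsFiniteMeasure μ] [SigmaFinite ρ] (hfμ : Integrable f μ)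
    (hfρ : Integrable (fun x => Real.exp (f x)) ρ) :
    klDiv μ (ρ.tilted f) ≠ ∞ ↔ klDiv μ ρ ≠ ∞ := by
  have hac : μ ≪ ρ.tilted f ↔ μ ≪ ρ :=
    ⟨fun h => h.trans (tilted_absolutelyContinuous ρ f),
      fun h => h.trans (absolutelyContinuous_tilted hfρ)⟩
  rw [klDiv_ne_top_iff, klDiv_ne_top_iff, hac]
  exact and_congr_right fun hμρ => integrable_llr_tilted_right_iff hμρ hfμ hfρ

-- Stated in `EReal`, since the additive constant can be negative while both divergences can be `∞`.
lemma coe_klDiv_eq_coe_klDiv_tilted_add [IsProbabilityMeasure μ] [IsProbabilityMeasure ρ]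
    (hfμ : Integrable f μ) (hfρ : Integrable (fun x => Real.exp (f x)) ρ) :
    (klDiv μ ρ : EReal) = klDiv μ (ρ.tilted f) +
      ((∫ x, f x ∂μ - Real.log (∫ x, Real.exp (f x) ∂ρ) : ℝ) : EReal) := by
  have : IsProbabilityMeasure (ρ.tilted f) := isProbabilityMeasure_tilted hfρ
  have hiff := klDiv_tilted_right_ne_top_iff hfμ hfρ
  by_cases htop : klDiv μ ρ = ∞
  · have htop' : klDiv μ (ρ.tilted f) = ∞ := by simpa [htop] using hiff
    rw [htop, htop', EReal.coe_ennreal_top, EReal.top_add_coe]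
  obtain ⟨hac, hint⟩ := klDiv_ne_top_iff.1 htop
  have hac' := hac.trans (absolutelyContinuous_tilted hfρ)
  rw [← EReal.coe_ennreal_toReal htop, ← EReal.coe_ennreal_toReal (hiff.2 htop),
    ← EReal.coe_add, toReal_klDiv_of_measure_eq hac (by simp),
    toReal_klDiv_of_measure_eq hac' (by simp), integral_llr_tilted_right hac hfμ hfρ hint]
  congr 1
  ring

end Tilting

section Quadratic

variable {m n : Type*} [Fintype m] [Fintype n]

/-- The quadratic form `x ↦ ⟨x, P x⟩ / 2`. With `P = S⁻¹` it is, up to an additive constant, minus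
the logarithm of the density of the Gaussian measure with covariance matrix `S`. -/
noncomputable def halfQuadForm (P : Matrix n n ℝ) (x : EuclideanSpace ℝ n) : ℝ :=
  (x.ofLp ⬝ᵥ P *ᵥ x.ofLp) / 2

@[fun_prop]
lemma continuous_halfQuadForm (P : Matrix n n ℝ) : Continuous (halfQuadForm P) := by
  unfold halfQuadForm
  fun_prop

lemma halfQuadForm_add (P Q : Matrix n n ℝ) (x : EuclideanSpace ℝ n) :
    halfQuadForm (P + Q) x = halfQuadForm P x + halfQuadForm Q x := by
  simp only [halfQuadForm, add_mulVec, dotProduct_add, add_div]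

lemma halfQuadForm_sub (P Q : Matrix n n ℝ) (x : EuclideanSpace ℝ n) :
    halfQuadForm (P - Q) x = halfQuadForm P x - halfQuadForm Q x := by
  simp only [halfQuadForm, sub_mulVec, dotProduct_sub, sub_div]

lemma halfQuadForm_smul_one [DecidableEq n] (c : ℝ) (x : EuclideanSpace ℝ n) :
    halfQuadForm (c • 1) x = c * (‖x‖ ^ 2 / 2) := by
  have hnorm : x.ofLp ⬝ᵥ x.ofLp = ‖x‖ ^ 2 := by
    rw [EuclideanSpace.real_norm_sq_eq]
    simp only [dotProduct, sq]
  rw [halfQuadForm, smul_mulVec, one_mulVec, dotProduct_smul, hnorm, smul_eq_mul, mul_div_assoc]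

lemma halfQuadForm_toEuclideanCLM [DecidableEq n] (P Q : Matrix n n ℝ) (x : EuclideanSpace ℝ n) :
    halfQuadForm P (toEuclideanCLM (𝕜 := ℝ) Q x) = halfQuadForm (Qᵀ * P * Q) x := by
  simp only [halfQuadForm, ofLp_toEuclideanCLM, ← mulVec_mulVec, dotProduct_mulVec,
    vecMul_transpose]

lemma halfQuadForm_sumEquivProd_symm {W : Matrix (m ⊕ n) (m ⊕ n) ℝ} (hW : W.IsSymm)
    (x : EuclideanSpace ℝ m) (y : EuclideanSpace ℝ n) :
    halfQuadForm W (EuclideanSpace.sumEquivProd.symm (x, y)) =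
      halfQuadForm W.toBlocks₁₁ x + x.ofLp ⬝ᵥ W.toBlocks₁₂ *ᵥ y.ofLp +
        halfQuadForm W.toBlocks₂₂ y := by
  have hz : (EuclideanSpace.sumEquivProd.symm (x, y)).ofLp = Sum.elim x.ofLp y.ofLp := by
    ext (i | j) <;> rfl
  have h₂₁ : W.toBlocks₂₁ = W.toBlocks₁₂ᵀ := by
    ext i j
    exact hW.apply _ _
  have hcross : y.ofLp ⬝ᵥ W.toBlocks₂₁ *ᵥ x.ofLp = x.ofLp ⬝ᵥ W.toBlocks₁₂ *ᵥ y.ofLp := by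
    rw [h₂₁, mulVec_transpose, dotProduct_comm, dotProduct_mulVec]
  have hmul : W *ᵥ Sum.elim x.ofLp y.ofLp =
      Sum.elim (W.toBlocks₁₁ *ᵥ x.ofLp + W.toBlocks₁₂ *ᵥ y.ofLp)
        (W.toBlocks₂₁ *ᵥ x.ofLp + W.toBlocks₂₂ *ᵥ y.ofLp) := by
    nth_rewrite 1 [← fromBlocks_toBlocks W]
    rw [fromBlocks_mulVec, Sum.elim_comp_inl, Sum.elim_comp_inr]
  simp only [halfQuadForm, hz, hmul, sumElim_dotProduct_sumElim, dotProduct_add, hcross]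
  ring

lemma integrable_halfQuadForm {μ : Measure (EuclideanSpace ℝ n)}
    (hμ : Integrable (fun x => ‖x‖ ^ 2) μ) (P : Matrix n n ℝ) :
    Integrable (halfQuadForm P) μ := by
  classical
  refine (hμ.const_mul (‖toEuclideanCLM (𝕜 := ℝ) P‖ / 2)).mono'
    (Continuous.aestronglyMeasurable (by fun_prop)) (ae_of_all _ fun x => ?_)
  have hop := (norm_inner_le_norm (𝕜 := ℝ) x (toEuclideanCLM (𝕜 := ℝ) P x)).trans
    (mul_le_mul_of_nonneg_left ((toEuclideanCLM (𝕜 := ℝ) P).le_opNorm x) (norm_nonneg x))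
  rw [halfQuadForm, ← inner_toEuclideanCLM, norm_div, Real.norm_ofNat]
  linarith only [hop]

end Quadratic

section GaussianDensity

variable {E : Type*} [NormedAddCommGroup E] [InnerProductSpace ℝ E] [MeasurableSpace E]

lemma charFun_tilted (μ : Measure E) (f : E → ℝ) (t : E) :
    charFun (μ.tilted f) t =
      (∫ x, Complex.exp (f x + Complex.I * inner ℝ t x) ∂μ) / ∫ x, Complex.exp (f x) ∂μ := by
  have hZ : ∫ x, Complex.exp (f x) ∂μ = (∫ x, Real.exp (f x) ∂μ : ℝ) := by
    simp only [← Complex.ofReal_exp, integral_complex_ofReal]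
  rw [charFun_apply, integral_tilted, hZ, ← integral_div]
  refine integral_congr_ae (ae_of_all _ fun x => ?_)
  simp only [Complex.real_smul, Complex.ofReal_div, Complex.ofReal_exp, Complex.exp_add,
    real_inner_comm x t, mul_comm Complex.I]
  ring

variable [FiniteDimensional ℝ E] [BorelSpace E]

variable (E) in
lemma integrable_exp_neg_half_norm_sq : Integrable fun x : E => Real.exp (-(‖x‖ ^ 2 / 2)) := by
  have hint := (GaussianFourier.integrable_cexp_neg_mul_sq_norm_add (V := E) (b := (1 / 2 : ℝ))
    (by norm_num) 0 0).norm
  refine hint.congr (ae_of_all _ fun x => ?_)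
  simp only [Complex.norm_exp, zero_mul, add_zero, ← Complex.ofReal_pow, ← Complex.ofReal_neg,
    ← Complex.ofReal_mul, Complex.ofReal_re]
  ring_nf

lemma stdGaussian_eq_tilted : stdGaussian E = volume.tilted fun x => -(‖x‖ ^ 2 / 2) := by
  have := isProbabilityMeasure_tilted (integrable_exp_neg_half_norm_sq E)
  have hb : 0 < (1 / 2 : ℂ).re := by norm_num
  have hcast (x : E) : ((-(‖x‖ ^ 2 / 2) : ℝ) : ℂ) = -(1 / 2) * (‖x‖ : ℂ) ^ 2 := by
    push_cast
    ring
  have hZ : ((Real.pi : ℂ) / (1 / 2)) ^ (Module.finrank ℝ E / 2 : ℂ) ≠ 0 := by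
    simp [Real.pi_ne_zero]
  refine Measure.ext_of_charFun (funext fun t => ?_)
  simp only [charFun_stdGaussian, charFun_tilted, hcast]
  rw [GaussianFourier.integral_cexp_neg_mul_sq_norm_add hb,
    GaussianFourier.integral_cexp_neg_mul_sq_norm hb, mul_div_cancel_left₀ _ hZ, Complex.I_sq]
  congr 1
  ring

end GaussianDensity

section MultivariateGaussian

variable {m n : Type*} [Fintype m] [DecidableEq m] [Fintype n] [DecidableEq n]

lemma det_toEuclideanCLM (Q : Matrix n n ℝ) :
    LinearMap.det (toEuclideanCLM (𝕜 := ℝ) Q : EuclideanSpace ℝ n →ₗ[ℝ] EuclideanSpace ℝ n) =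
      Q.det := by
  rw [coe_toEuclideanCLM_eq_toEuclideanLin, toEuclideanLin_eq_toLin_orthonormal,
    LinearMap.det_toLin]

lemma map_toEuclideanCLM_volume_tilted {Q : Matrix n n ℝ} (hQ : IsUnit Q)
    {f : EuclideanSpace ℝ n → ℝ} (hf : Measurable f) :
    (volume.tilted (f ∘ toEuclideanCLM (𝕜 := ℝ) Q)).map (toEuclideanCLM (𝕜 := ℝ) Q) =
      volume.tilted f := by
  have hdet : LinearMap.det (toEuclideanCLM (𝕜 := ℝ) Q :
      EuclideanSpace ℝ n →ₗ[ℝ] EuclideanSpace ℝ n) ≠ 0 := by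
    rw [det_toEuclideanCLM]
    exact ((isUnit_iff_isUnit_det Q).1 hQ).ne_zero
  rw [map_tilted_comp (by fun_prop) hf, ← ContinuousLinearMap.coe_coe,
    Measure.map_linearMap_addHaar_eq_smul_addHaar _ hdet,
    smul_tilted (by simpa using hdet) ENNReal.ofReal_ne_top]

lemma sqrt_mul_inv_mul_sqrt {S : Matrix n n ℝ} (hS : S.PosDef) :
    CFC.sqrt S * S⁻¹ * CFC.sqrt S = 1 := by
  have hdet := (isUnit_iff_isUnit_det _).1 hS.isStrictlyPositive.isUnit_cfcSqrt
  have hsq := CFC.sqrt_mul_sqrt_self S hS.posSemidef.nonneg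
  set R := CFC.sqrt S
  rw [← hsq, Matrix.mul_inv_rev, mul_nonsing_inv_cancel_left _ _ hdet, nonsing_inv_mul _ hdet]

lemma multivariateGaussian_eq_tilted {S : Matrix n n ℝ} (hS : S.PosDef) :
    multivariateGaussian 0 S = volume.tilted fun z => -halfQuadForm S⁻¹ z := by
  have hcomp : (fun x : EuclideanSpace ℝ n => -(‖x‖ ^ 2 / 2)) =
      (fun z => -halfQuadForm S⁻¹ z) ∘ toEuclideanCLM (𝕜 := ℝ) (CFC.sqrt S) := by
    funext x
    rw [Function.comp_apply, halfQuadForm_toEuclideanCLM, ← conjTranspose_eq_transpose_of_trivial,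
      conjTranspose_sqrt, sqrt_mul_inv_mul_sqrt hS, ← one_smul ℝ (1 : Matrix n n ℝ),
      halfQuadForm_smul_one, one_mul]
  simp only [multivariateGaussian, zero_add]
  rw [stdGaussian_eq_tilted, hcomp, map_toEuclideanCLM_volume_tilted
    hS.isStrictlyPositive.isUnit_cfcSqrt (by fun_prop)]

lemma multivariateGaussian_eq_tilted_multivariateGaussian {S T : Matrix n n ℝ} (hS : S.PosDef)
    (hT : T.PosDef) :
    multivariateGaussian 0 T = (multivariateGaussian 0 S).tilted (halfQuadForm (S⁻¹ - T⁻¹)) := by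
  have hint : Integrable (fun z : EuclideanSpace ℝ n => Real.exp (-halfQuadForm S⁻¹ z)) := by
    refine integrable_exp_of_tilted_ne_zero ?_
    rw [← multivariateGaussian_eq_tilted hS]
    exact IsProbabilityMeasure.ne_zero _
  rw [multivariateGaussian_eq_tilted hS, multivariateGaussian_eq_tilted hT, tilted_tilted hint]
  congr 1
  funext z
  rw [Pi.add_apply, halfQuadForm_sub]
  ring

lemma map_multivariateGaussian_of_apply_eq {μ : EuclideanSpace ℝ n} {S : Matrix n n ℝ}
    (hS : S.PosSemidef) {g : m → n} {L : EuclideanSpace ℝ n →L[ℝ] EuclideanSpace ℝ m}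
    (hL : ∀ z i, L z i = z (g i)) :
    (multivariateGaussian μ S).map L = multivariateGaussian (L μ) (S.submatrix g g) := by
  apply IsGaussian.ext
  · simp only [id_eq, integral_id_multivariateGaussian]
    rw [ContinuousLinearMap.integral_id_map, integral_id_multivariateGaussian]
    exact IsGaussian.integrable_id
  rw [← ContinuousLinearMap.toBilinForm_inj]
  refine LinearMap.BilinForm.ext_basis (EuclideanSpace.basisFun m ℝ).toBasis fun i j => ?_
  rw [ContinuousLinearMap.toBilinForm_apply, ContinuousLinearMap.toBilinForm_apply,
    covarianceBilin_apply_eq_cov IsGaussian.memLp_two_id,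
    covariance_map (Measurable.aestronglyMeasurable (by fun_prop))
      (Measurable.aestronglyMeasurable (by fun_prop)) (by fun_prop)]
  have hcoord (i : m) : (fun u => inner ℝ ((EuclideanSpace.basisFun m ℝ).toBasis i) u) ∘ L =
      fun u => u (g i) := by ext u; simp [PiLp.inner_apply, hL]
  simp_rw [hcoord, covariance_eval_multivariateGaussian hS,
    covarianceBilin_multivariateGaussian (hS.submatrix _)]
  simp

lemma integrable_norm_sq_multivariateGaussian (μ : EuclideanSpace ℝ n) (S : Matrix n n ℝ) :
    Integrable (fun x => ‖x‖ ^ 2) (multivariateGaussian μ S) :=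
  IsGaussian.memLp_two_id.integrable_norm_pow two_ne_zero

end MultivariateGaussian

section Couplings

variable {d : ℕ} {μ ν : Measure (Space d)} {π : Measure (Space d × Space d)} {f g : Space d → ℝ}

lemma integrable_comp_fst_of_mem_couplings (hπ : π ∈ couplings μ ν) (hf : Integrable f μ) :
    Integrable (fun p => f p.1) π :=
  (hπ.2.1 ▸ hf : Integrable f (π.map Prod.fst)).comp_measurable measurable_fst

lemma integrable_comp_snd_of_mem_couplings (hπ : π ∈ couplings μ ν) (hg : Integrable g ν) :
    Integrable (fun p => g p.2) π :=
  (hπ.2.2 ▸ hg : Integrable g (π.map Prod.snd)).comp_measurable measurable_snd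

lemma integral_comp_add_comp_of_mem_couplings (hπ : π ∈ couplings μ ν) (hf : Integrable f μ)
    (hg : Integrable g ν) : ∫ p, (f p.1 + g p.2) ∂π = ∫ x, f x ∂μ + ∫ y, g y ∂ν := by
  rw [integral_add (integrable_comp_fst_of_mem_couplings hπ hf)
    (integrable_comp_snd_of_mem_couplings hπ hg)]
  obtain ⟨-, rfl, rfl⟩ := hπ
  rw [integral_map measurable_fst.aemeasurable hf.aestronglyMeasurable,
    integral_map measurable_snd.aemeasurable hg.aestronglyMeasurable]

lemma integrable_norm_sub_sq_of_mem_couplings (hπ : π ∈ couplings μ ν)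
    (hμ : Integrable (fun x => ‖x‖ ^ 2) μ) (hν : Integrable (fun y => ‖y‖ ^ 2) ν) :
    Integrable (fun p => ‖p.1 - p.2‖ ^ 2) π := by
  refine (((integrable_comp_fst_of_mem_couplings hπ hμ).add
    (integrable_comp_snd_of_mem_couplings hπ hν)).const_mul 2).mono'
    (Continuous.aestronglyMeasurable (by fun_prop)) (ae_of_all _ fun p => ?_)
  rw [Real.norm_of_nonneg (by positivity)]
  have hpar := parallelogram_law_with_norm ℝ p.1 p.2
  simp only [Pi.add_apply]
  nlinarith only [hpar, sq_nonneg ‖p.1 + p.2‖]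

end Couplings

section Variational

variable {d : ℕ} {μ ν : Measure (Space d)} {ρ π π' : Measure (Space d × Space d)}
  {a b : Space d → ℝ} {ε : ℝ}

/-- The function `a x + b y - ‖x - y‖² / (2 ε)` of `(x, y)`. The entropic optimal plan with
reference measure `ρ` is the exponential tilt of `ρ` by it, where the Schrödinger potentials `a`
and `b` adjust the two marginals. -/
noncomputable def schrodingerExponent (ε : ℝ) (a b : Space d → ℝ) (p : Space d × Space d) : ℝ :=
  a p.1 + b p.2 - ‖p.1 - p.2‖ ^ 2 / (2 * ε)

lemma integrable_schrodingerExponent (hπ : π ∈ couplings μ ν)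
    (hμ : Integrable (fun x => ‖x‖ ^ 2) μ) (hν : Integrable (fun y => ‖y‖ ^ 2) ν)
    (ha : Integrable a μ) (hb : Integrable b ν) : Integrable (schrodingerExponent ε a b) π :=
  ((integrable_comp_fst_of_mem_couplings hπ ha).add
    (integrable_comp_snd_of_mem_couplings hπ hb)).sub
    ((integrable_norm_sub_sq_of_mem_couplings hπ hμ hν).div_const _)

lemma integral_schrodingerExponent (hπ : π ∈ couplings μ ν)
    (hμ : Integrable (fun x => ‖x‖ ^ 2) μ) (hν : Integrable (fun y => ‖y‖ ^ 2) ν)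
    (ha : Integrable a μ) (hb : Integrable b ν) :
    ∫ p, schrodingerExponent ε a b p ∂π =
      ∫ x, a x ∂μ + ∫ y, b y ∂ν - (∫ p, ‖p.1 - p.2‖ ^ 2 ∂π) / (2 * ε) := by
  have hab : Integrable (fun p => a p.1 + b p.2) π :=
    (integrable_comp_fst_of_mem_couplings hπ ha).add (integrable_comp_snd_of_mem_couplings hπ hb)
  simp only [schrodingerExponent]
  rw [integral_sub hab ((integrable_norm_sub_sq_of_mem_couplings hπ hμ hν).div_const _),
    integral_comp_add_comp_of_mem_couplings hπ ha hb, integral_div]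

lemma coe_objective_eq [IsProbabilityMeasure ρ] (hμ : Integrable (fun x => ‖x‖ ^ 2) μ)
    (hν : Integrable (fun y => ‖y‖ ^ 2) ν) (ha : Integrable a μ) (hb : Integrable b ν)
    (hε : 0 < ε) (hτ : ρ.tilted (schrodingerExponent ε a b) ≠ 0) (hπ : π ∈ couplings μ ν) :
    (objective ε ρ π : EReal) =
      (ENNReal.ofReal (2 * ε) * klDiv π (ρ.tilted (schrodingerExponent ε a b)) : ℝ≥0∞) +
      (2 * ε * (∫ x, a x ∂μ + ∫ y, b y ∂ν -
        Real.log (∫ p, Real.exp (schrodingerExponent ε a b p) ∂ρ)) : ℝ) := by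
  have := hπ.1
  have hcost : ∫⁻ p, ENNReal.ofReal (‖p.1 - p.2‖ ^ 2) ∂π =
      ENNReal.ofReal (∫ p, ‖p.1 - p.2‖ ^ 2 ∂π) :=
    (ofReal_integral_eq_lintegral_ofReal (integrable_norm_sub_sq_of_mem_couplings hπ hμ hν)
      (ae_of_all _ fun p => by positivity)).symm
  rw [objective, hcost, EReal.coe_ennreal_add, EReal.coe_ennreal_mul, EReal.coe_ennreal_mul,
    coe_klDiv_eq_coe_klDiv_tilted_add (integrable_schrodingerExponent hπ hμ hν ha hb)
      (integrable_exp_of_tilted_ne_zero hτ), integral_schrodingerExponent hπ hμ hν ha hb,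
    EReal.coe_ennreal_ofReal, EReal.coe_ennreal_ofReal, max_eq_left (by positivity),
    max_eq_left (by positivity), EReal.left_distrib_of_nonneg_of_ne_top (by positivity)
      (EReal.coe_ne_top _), add_left_comm, ← EReal.coe_mul, ← EReal.coe_add]
  congr 2
  field_simp
  ring

lemma objective_le_objective_iff [IsProbabilityMeasure ρ] (hμ : Integrable (fun x => ‖x‖ ^ 2) μ)
    (hν : Integrable (fun y => ‖y‖ ^ 2) ν) (ha : Integrable a μ) (hb : Integrable b ν)
    (hε : 0 < ε) (hτ : ρ.tilted (schrodingerExponent ε a b) ≠ 0) (hπ : π ∈ couplings μ ν)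
    (hπ' : π' ∈ couplings μ ν) :
    objective ε ρ π ≤ objective ε ρ π' ↔
      klDiv π (ρ.tilted (schrodingerExponent ε a b)) ≤
        klDiv π' (ρ.tilted (schrodingerExponent ε a b)) := by
  rw [← EReal.coe_ennreal_le_coe_ennreal_iff, coe_objective_eq hμ hν ha hb hε hτ hπ,
    coe_objective_eq hμ hν ha hb hε hτ hπ', (EReal.addLECancellable_coe _).add_le_add_iff_right,
    EReal.coe_ennreal_le_coe_ennreal_iff,
    ENNReal.mul_le_mul_iff_right (by simpa) ENNReal.ofReal_ne_top]

lemma isSolution_iff_eq_tilted [IsProbabilityMeasure ρ]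
    (hμ : Integrable (fun x => ‖x‖ ^ 2) μ) (hν : Integrable (fun y => ‖y‖ ^ 2) ν)
    (ha : Integrable a μ) (hb : Integrable b ν) (hε : 0 < ε)
    (hτ : ρ.tilted (schrodingerExponent ε a b) ∈ couplings μ ν) :
    IsSolution ε ρ μ ν π ↔ π = ρ.tilted (schrodingerExponent ε a b) := by
  have := hτ.1
  have hτ0 : ρ.tilted (schrodingerExponent ε a b) ≠ 0 := IsProbabilityMeasure.ne_zero _
  have hle {π π'} (hπ : π ∈ couplings μ ν) (hπ' : π' ∈ couplings μ ν) :=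
    objective_le_objective_iff hμ hν ha hb hε hτ0 hπ hπ'
  constructor
  · rintro ⟨hπ, hmin⟩
    have := hπ.1
    have hkl := (hle hπ hτ).1 (hmin hτ)
    rwa [klDiv_self, nonpos_iff_eq_zero, klDiv_eq_zero_iff] at hkl
  · rintro rfl
    refine ⟨hτ, fun π hπ => (hle hτ hπ).2 ?_⟩
    rw [klDiv_self]
    exact zero_le

end Variational

section GaussianCouplings

variable {d : ℕ}

instance (X : Matrix (Fin d ⊕ Fin d) (Fin d ⊕ Fin d) ℝ) : IsProbabilityMeasure (gaussianProd X) :=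
  Measure.isProbabilityMeasure_map (by fun_prop)

lemma gaussianProd_covOf_mem_couplings {A B C : Matrix (Fin d) (Fin d) ℝ}
    (h : (covOf A B C).PosSemidef) :
    gaussianProd (covOf A B C) ∈ couplings (gaussian A) (gaussian B) := by
  let e : EuclideanSpace ℝ (Fin d ⊕ Fin d) →L[ℝ] Space d × Space d :=
    (EuclideanSpace.sumEquivProd (𝕜 := ℝ)).toContinuousLinearMap
  refine ⟨inferInstance, ?_, ?_⟩
  · have hfst := map_multivariateGaussian_of_apply_eq (μ := 0) h (g := Sum.inl)
      (L := (ContinuousLinearMap.fst ℝ (Space d) (Space d)).comp e) fun _ _ => rfl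
    rw [map_zero] at hfst
    rw [gaussianProd, Measure.map_map measurable_fst (by fun_prop)]
    exact hfst
  · have hsnd := map_multivariateGaussian_of_apply_eq (μ := 0) h (g := Sum.inr)
      (L := (ContinuousLinearMap.snd ℝ (Space d) (Space d)).comp e) fun _ _ => rfl
    rw [map_zero] at hsnd
    rw [gaussianProd, Measure.map_map measurable_snd (by fun_prop)]
    exact hsnd

lemma halfQuadForm_sumEquivProd_symm_eq_schrodingerExponent
    {D : Matrix (Fin d ⊕ Fin d) (Fin d ⊕ Fin d) ℝ} (hD : D.IsSymm) {ε : ℝ}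
    (hD₁₂ : D.toBlocks₁₂ = ε⁻¹ • 1) (p : Space d × Space d) :
    halfQuadForm D (EuclideanSpace.sumEquivProd.symm p) =
      schrodingerExponent ε (halfQuadForm (D.toBlocks₁₁ + ε⁻¹ • 1))
        (halfQuadForm (D.toBlocks₂₂ + ε⁻¹ • 1)) p := by
  have hinner : p.1.ofLp ⬝ᵥ p.2.ofLp = inner ℝ p.1 p.2 := by
    simp only [PiLp.inner_apply, dotProduct, RCLike.inner_apply, conj_trivial, mul_comm]
  rw [halfQuadForm_sumEquivProd_symm hD p.1 p.2, hD₁₂, schrodingerExponent, halfQuadForm_add,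
    halfQuadForm_add, halfQuadForm_smul_one, halfQuadForm_smul_one, norm_sub_sq_real, smul_mulVec,
    one_mulVec, dotProduct_smul, smul_eq_mul, hinner, mul_comm 2 ε, ← div_div, div_eq_inv_mul _ ε]
  ring

lemma gaussianProd_eq_tilted_schrodingerExponent
    {S T : Matrix (Fin d ⊕ Fin d) (Fin d ⊕ Fin d) ℝ} (hS : S.PosDef) (hT : T.PosDef) {ε : ℝ}
    (hST : (S⁻¹ - T⁻¹).toBlocks₁₂ = ε⁻¹ • 1) :
    gaussianProd T = (gaussianProd S).tilted
      (schrodingerExponent ε (halfQuadForm ((S⁻¹ - T⁻¹).toBlocks₁₁ + ε⁻¹ • 1))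
        (halfQuadForm ((S⁻¹ - T⁻¹).toBlocks₂₂ + ε⁻¹ • 1))) := by
  have hsymm : (S⁻¹ - T⁻¹).IsSymm := hS.inv.isHermitian.sub hT.inv.isHermitian
  rw [gaussianProd, gaussianProd, multivariateGaussian_eq_tilted_multivariateGaussian hS hT,
    ← funext (halfQuadForm_sumEquivProd_symm_eq_schrodingerExponent hsymm hST),
    ← map_tilted_comp (by fun_prop) (by fun_prop)]
  simp only [Function.comp_def, ContinuousLinearEquiv.symm_apply_apply]

lemma isSolution_gaussianProd_covOf_iff {S : Matrix (Fin d ⊕ Fin d) (Fin d ⊕ Fin d) ℝ}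
    {A B C : Matrix (Fin d) (Fin d) ℝ} (hS : S.PosDef) (hT : (covOf A B C).PosDef) {ε : ℝ}
    (hε : 0 < ε) (hST : (S⁻¹ - (covOf A B C)⁻¹).toBlocks₁₂ = ε⁻¹ • 1)
    {π : Measure (Space d × Space d)} :
    IsSolution ε (gaussianProd S) (gaussian A) (gaussian B) π ↔
      π = gaussianProd (covOf A B C) := by
  have htilt := gaussianProd_eq_tilted_schrodingerExponent hS hT hST
  have hA := integrable_norm_sq_multivariateGaussian 0 A
  have hB := integrable_norm_sq_multivariateGaussian 0 B
  have hmem := gaussianProd_covOf_mem_couplings hT.posSemidef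
  rw [htilt] at hmem ⊢
  exact isSolution_iff_eq_tilted hA hB (integrable_halfQuadForm hA _) (integrable_halfQuadForm hB _)
    hε hmem

end GaussianCouplings

end EntropicOT

theorem mainTheorem1 (d : ℕ) (A B : Matrix (Fin d) (Fin d) ℝ) (hA : A.PosDef) (hB : B.PosDef)
    (S : Matrix (Fin d ⊕ Fin d) (Fin d ⊕ Fin d) ℝ) (hS : S.PosDef) :
    (∀ᶠ ε in 𝓝[>] (0 : ℝ), IsUnit (EntropicOT.Meps S ε)) ∧
    ∀ ε : ℝ, 0 < ε → IsUnit (EntropicOT.Meps S ε) →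
      (EntropicOT.covOf A B (EntropicOT.Ceps A B S ε)).PosSemidef ∧
      ∀ π : MeasureTheory.Measure (EntropicOT.Space d × EntropicOT.Space d),
        EntropicOT.IsSolution ε (EntropicOT.gaussianProd S)
            (EntropicOT.gaussian A) (EntropicOT.gaussian B) π ↔
          π = EntropicOT.gaussianProd (EntropicOT.covOf A B (EntropicOT.Ceps A B S ε)) :=
  ⟨EntropicOT.eventually_isUnit_Meps S, fun _ hε hM =>
    ⟨(EntropicOT.posDef_covOf_Ceps hA hB hε hM).posSemidef, fun _ =>
      EntropicOT.isSolution_gaussianProd_covOf_iff hS (EntropicOT.posDef_covOf_Ceps hA hB hε hM) hε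
        (EntropicOT.toBlocks₁₂_inv_sub_inv_covOf_Ceps hA hB hε hM)⟩⟩
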